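/- Let $\mathbb{H}$ be the real quaternions, and for $\mathbb{F}\in\{\mathbb{R},\mathbb{H}\}$ let $\mathbb{DF}=\{a_s+\epsilon a_i : a_s,a_i\in\mathbb{F}\}$ be the ring of dual numbers over $\mathbb{F}$, where $\epsilon$ commutes with $\mathbb{F}$ and $\epsilon^2=0$. For a dual quaternion matrix $A=A_s+\epsilon A_i\in\mathbb{DH}^{m\times n}$, with $A_s,A_i\in\mathbb{H}^{m\times n}$, let $A^H=A_s^H+\epsilon A_i^H$ be its conjugate transpose. A square matrix $V\in\mathbb{DH}^{n\times n}$ is unitary if $VV^H=V^HV=I_n$. Let $\eta\in\mathbb{H}$ be a unit pure imaginary quaternion, that is, $\eta$ has real part $0$ and $|\eta|=1$, and put $A^{\eta H}=\eta^H A^H\eta$ with $\eta^H=\bar\eta=-\eta$, where $\eta^H$ and $\eta$ multiply every entry from the left and from the right, respectively. A matrix $A\in\mathbb{DH}^{n\times n}$ is called $\eta$-Hermitian if $A=A^{\eta H}$. Theorem. For every $\eta$-Hermitian dual quaternion matrix $A=A_s+\epsilon A_i\in\mathbb{DH}^{n\times n}$ there exist a unitary matrix $V=V_s+\epsilon V_i\in\mathbb{DH}^{n\times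 n}$ and a diagonal dual real matrix $\Sigma=\Sigma_s+\epsilon\Sigma_i\in\mathbb{DR}^{n\times n}$ such that $$A=V\Sigma V^{\eta H}.$$ -/

import Mathlib

open scoped Quaternion Matrix

/-- The dual quaternions `𝔻ℍ`: elements `q = q_s + ε q_i` with `ε ^ 2 = 0` and `q_s, q_i ∈ ℍ`.
The standard part `q_s` is `q.fst`, the infinitesimal part `q_i` is `q.snd`. -/
abbrev DualQuat : Type := DualNumber ℍ[ℝ]

/-- The conjugate of a dual quaternion is taken part by part:
`star (q_s + ε q_i) = star q_s + ε star q_i`. -/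
instance DualQuat.instStarRing : StarRing DualQuat where
  star q := (star q.fst, star q.snd)
  star_involutive q := TrivSqZeroExt.ext (star_star q.fst) (star_star q.snd)
  star_mul p q := by
    refine TrivSqZeroExt.ext ?_ ?_
    · change star (p * q).fst = star q.fst * star p.fst
      rw [TrivSqZeroExt.fst_mul, star_mul]
    · change star (p * q).snd = star q.fst * star p.snd + star q.snd * star p.fst
      rw [TrivSqZeroExt.snd_mul, star_add]
      change star (p.fst * q.snd) + star (p.snd * q.fst) = _
      rw [star_mul, star_mul, add_comm]
  star_add p q := TrivSqZeroExt.ext (star_add p.fst q.fst) (star_add p.snd q.snd)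

@[simp]
theorem DualQuat.fst_star (q : DualQuat) : (star q).fst = star q.fst := rfl

@[simp]
theorem DualQuat.snd_star (q : DualQuat) : (star q).snd = star q.snd := rfl

/-- The inclusion `𝔻ℝ → 𝔻ℍ` of the dual real numbers into the dual quaternions,
`d_s + ε d_i ↦ d_s + ε d_i`. -/
noncomputable def DualQuat.ofDualReal (d : DualNumber ℝ) : DualQuat :=
  TrivSqZeroExt.inl (d.fst : ℍ[ℝ]) + TrivSqZeroExt.inr (d.snd : ℍ[ℝ])

/-- A unit pure imaginary quaternion: real part zero and norm one. -/
def IsUnitPureImaginary (η : ℍ[ℝ]) : Prop :=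
  η.re = 0 ∧ ‖η‖ = 1

/-- The `η`-conjugate transpose `A^{ηH} = η^H A^H η` of a dual quaternion matrix, where `A^H` is the
conjugate transpose, `η^H` is the conjugate of `η`, and both act as scalars on every entry. -/
noncomputable def etaConjTranspose {m n : ℕ} (η : ℍ[ℝ]) (A : Matrix (Fin m) (Fin n) DualQuat) :
    Matrix (Fin n) (Fin m) DualQuat :=
  Aᴴ.map fun q => TrivSqZeroExt.inl (star η) * q * TrivSqZeroExt.inl η

/-- A square dual quaternion matrix `A` is `η`-Hermitian if `A = A^{ηH}`. -/
def IsEtaHermitian {n : ℕ} (η : ℍ[ℝ]) (A : Matrix (Fin n) (Fin n) DualQuat) : Prop :=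
  A = etaConjTranspose η A

/-!
Write `J` for the scalar matrix `η I`, so that `J² = -1` and `A^{ηH} = -J Aᴴ J`. Then `A` is
`η`-Hermitian exactly when `B = A J` is skew-Hermitian, and `A = V Σ V^{ηH}` is equivalent to
`B = V (Σ J) Vᴴ`. What has to be proved is therefore a spectral theorem: every skew-Hermitian dual
quaternion matrix is unitarily similar to a diagonal matrix with entries in `𝔻ℝ η`
(`DualQuat.exists_unitary_mul_etaDiagonal`).

Over `ℍ` this is obtained without eigenvectors. Let `N = diag ((k + 1) η)`. On the compact group of
unitary matrices the function `U ↦ re tr (Uᴴ B U N)` has a maximum; differentiating along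
`t ↦ U exp (t P)` for skew-Hermitian `P` shows that `M = Uᴴ B U` satisfies `re tr (P [N, M]) = 0`,
and `P = [N, M]` gives `[N, M] = 0`. As the entries of `N` have distinct moduli, `M` is diagonal; its
entries are imaginary and commute with `η`, so they are real multiples of `η`
(`QuaternionMatrix.exists_eq_etaDiagonal`). The same argument works within the centralizer of a
diagonal matrix `D` with entries in `ℝ η` when `B` commutes with `D`
(`QuaternionMatrix.exists_unitary_etaDiagonal`).

For a dual matrix, first conjugate the standard part to such a `D`. The operator `ad D` is
skew-adjoint for the real trace form, so the new infinitesimal part is `C + [D, Q]` with `C` and `Q`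
skew-Hermitian and `C` commuting with `D` (`QuaternionMatrix.exists_commute_add_commutator`).
Conjugation by the unitary matrix `1 - ε Q` accounts for `[D, Q]`, and a unitary matrix
in the centralizer of `D` diagonalizes `C` while fixing `D`.
-/

/-! ### The real trace form on quaternion matrices -/

namespace QuaternionMatrix

theorem conjTranspose_real_smul {m n : Type*} (c : ℝ) (X : Matrix m n ℍ[ℝ]) :
    (c • X)ᴴ = c • Xᴴ :=
  Matrix.ext fun i j => Quaternion.star_smul c (X j i)

variable {ι : Type*} [Fintype ι]

theorem re_sum (p : ι → ℍ[ℝ]) : (∑ i, p i).re = ∑ i, (p i).re :=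
  map_sum (QuaternionAlgebra.reₗ (R := ℝ) (-1) 0 (-1)) _ _

/-- The real part of the trace of a quaternion matrix, as a real-linear form. Unlike the trace
itself it is cyclic, although multiplication in `ℍ` is not commutative. -/
noncomputable def reTrace : Matrix ι ι ℍ[ℝ] →ₗ[ℝ] ℝ where
  toFun X := X.trace.re
  map_add' X Y := by simp
  map_smul' c X := by simp [Matrix.trace_smul]

theorem reTrace_apply (X : Matrix ι ι ℍ[ℝ]) : reTrace X = ∑ i, (X i i).re :=
  re_sum fun i => X i i

theorem reTrace_mul_comm (X Y : Matrix ι ι ℍ[ℝ]) : reTrace (X * Y) = reTrace (Y * X) := by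
  simp only [reTrace_apply, Matrix.mul_apply, re_sum]
  rw [Finset.sum_comm]
  refine Finset.sum_congr rfl fun i _ => Finset.sum_congr rfl fun j _ => ?_
  simp only [Quaternion.re_mul]
  ring

theorem reTrace_mul_conjTranspose_self (X : Matrix ι ι ℍ[ℝ]) :
    reTrace (X * Xᴴ) = ∑ i, ∑ j, ‖X i j‖ ^ 2 := by
  simp only [reTrace_apply, Matrix.mul_apply, re_sum, Matrix.conjTranspose_apply,
    Quaternion.self_mul_star, Quaternion.re_coe, Quaternion.normSq_eq_norm_mul_self, sq]

theorem eq_zero_of_reTrace_mul_conjTranspose_self {X : Matrix ι ι ℍ[ℝ]}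
    (h : reTrace (X * Xᴴ) = 0) : X = 0 := by
  rw [reTrace_mul_conjTranspose_self] at h
  ext1 i j
  have h1 := (Finset.sum_eq_zero_iff_of_nonneg
    (fun i _ => Finset.sum_nonneg fun j _ => sq_nonneg ‖X i j‖)).1 h i (Finset.mem_univ i)
  have h2 := (Finset.sum_eq_zero_iff_of_nonneg
    (fun j _ => sq_nonneg ‖X i j‖)).1 h1 j (Finset.mem_univ j)
  simpa using h2

/-! ### Splitting off a commutator -/

/-- For skew-Hermitian `D` the operator `ad D = [D, ·]` is skew-adjoint for the form `re tr (X Yᴴ)`,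
so its kernel and range are complementary. -/
theorem exists_commute_add_commutator {D B : Matrix ι ι ℍ[ℝ]} (hD : Dᴴ = -D) (hB : Bᴴ = -B) :
    ∃ C Q : Matrix ι ι ℍ[ℝ], Cᴴ = -C ∧ Qᴴ = -Q ∧ D * C = C * D ∧ B = C + (D * Q - Q * D) := by
  -- `T` is `ad D`.
  let T : Matrix ι ι ℍ[ℝ] →ₗ[ℝ] Matrix ι ι ℍ[ℝ] := LinearMap.mulLeft ℝ D - LinearMap.mulRight ℝ D
  have hT (X : Matrix ι ι ℍ[ℝ]) : T X = D * X - X * D := rfl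
  have hdisj : Disjoint (LinearMap.ker T) (LinearMap.range T) := by
    rw [Submodule.disjoint_def]
    rintro _ hX ⟨Q, rfl⟩
    rw [LinearMap.mem_ker] at hX
    generalize hX' : T Q = X at hX
    rw [hT] at hX hX'
    apply eq_zero_of_reTrace_mul_conjTranspose_self
    have hXH : Xᴴ = D * Qᴴ - Qᴴ * D := by
      rw [← hX']
      simp only [Matrix.conjTranspose_sub, Matrix.conjTranspose_mul, hD]
      noncomm_ring
    have h1 : X * (D * Qᴴ - Qᴴ * D) = (X * D) * Qᴴ - (X * Qᴴ) * D := by noncomm_ring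
    rw [hXH, h1, map_sub, reTrace_mul_comm (X * Qᴴ) D, ← mul_assoc, ← map_sub, ← sub_mul,
      ← neg_sub (D * X), hX]
    simp
  have hcompl : LinearMap.ker T ⊔ LinearMap.range T = ⊤ := by
    apply Submodule.eq_top_of_disjoint _ _ _ hdisj
    rw [add_comm, LinearMap.finrank_range_add_finrank_ker]
  obtain ⟨C, hC, _, ⟨Q, rfl⟩, hCQ⟩ := Submodule.mem_sup.1 (hcompl ▸ Submodule.mem_top : B ∈ _)
  rw [LinearMap.mem_ker, hT] at hC
  rw [hT] at hCQ
  have hCH : D * Cᴴ - Cᴴ * D = 0 := by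
    have := congrArg Matrix.conjTranspose hC
    simp only [Matrix.conjTranspose_sub, Matrix.conjTranspose_mul, hD,
      Matrix.conjTranspose_zero] at this
    rw [← this]
    noncomm_ring
  have hBH : B = -Cᴴ + (D * -Qᴴ - -Qᴴ * D) := by
    have := congrArg Matrix.conjTranspose hCQ
    simp only [Matrix.conjTranspose_sub, Matrix.conjTranspose_add, Matrix.conjTranspose_mul, hD,
      hB] at this
    rw [← neg_neg B, ← this]
    noncomm_ring
  -- `C` and `Q` need not be skew-Hermitian; their skew-Hermitian parts serve as well.
  refine ⟨(2⁻¹ : ℝ) • (C - Cᴴ), (2⁻¹ : ℝ) • (Q - Qᴴ), ?_, ?_, ?_, ?_⟩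
  · rw [conjTranspose_real_smul, ← smul_neg]
    simp
  · rw [conjTranspose_real_smul, ← smul_neg]
    simp
  · rw [mul_smul_comm, smul_mul_assoc, mul_sub, sub_mul, sub_eq_zero.1 hC, sub_eq_zero.1 hCH]
  · have h2 : (C - Cᴴ) + (D * (Q - Qᴴ) - (Q - Qᴴ) * D) = (2 : ℝ) • B := by
      rw [two_smul]
      nth_rewrite 2 [hBH]
      rw [← hCQ]
      noncomm_ring
    rw [mul_smul_comm, smul_mul_assoc, ← smul_sub, ← smul_add, h2, smul_smul]
    norm_num

/-! ### Maximizing a trace over a centralizer in the unitary group -/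

variable [DecidableEq ι]

/-- Each row of a unitary matrix is a unit vector, so the entries are bounded by one. -/
theorem isCompact_setOf_unitary_commute (D : Matrix ι ι ℍ[ℝ]) :
    IsCompact {U : Matrix ι ι ℍ[ℝ] | U ∈ unitary (Matrix ι ι ℍ[ℝ]) ∧ U * D = D * U} := by
  have hbox : IsCompact {U : Matrix ι ι ℍ[ℝ] | ∀ i j, U i j ∈ Metric.closedBall 0 1} :=
    isCompact_pi_infinite fun _ => isCompact_pi_infinite fun _ => isCompact_closedBall 0 1
  refine hbox.of_isClosed_subset ?_ ?_
  · simp only [Unitary.mem_iff, Matrix.star_eq_conjTranspose]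
    refine IsClosed.inter (IsClosed.inter ?_ ?_) ?_ <;>
      exact isClosed_eq (by fun_prop) (by fun_prop)
  · rintro U ⟨hU, -⟩ i j
    have h0 : U * Uᴴ = 1 := Unitary.mul_star_self_of_mem hU
    have h1 : (U * Uᴴ) i i = (1 : Matrix ι ι ℍ[ℝ]) i i := by rw [h0]
    rw [Matrix.one_apply_eq, Matrix.mul_apply] at h1
    have h2 : ∑ k, ‖U i k‖ ^ 2 = 1 := by
      have := congrArg QuaternionAlgebra.re h1
      simpa [re_sum, Matrix.conjTranspose_apply, Quaternion.self_mul_star,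
        Quaternion.normSq_eq_norm_mul_self, sq] using this
    have h3 : ‖U i j‖ ^ 2 ≤ 1 := h2 ▸ Finset.single_le_sum
      (f := fun k => ‖U i k‖ ^ 2) (fun k _ => sq_nonneg _) (Finset.mem_univ j)
    rw [mem_closedBall_zero_iff]
    exact (sq_le_one_iff₀ (norm_nonneg _)).1 h3

/-- The derivative is `re tr ([M, P] N)`, rewritten by cyclicity of `reTrace`. -/
theorem hasDerivAt_reTrace_exp (M N P : Matrix ι ι ℍ[ℝ]) :
    HasDerivAt
      (fun t : ℝ => reTrace (NormedSpace.exp (t • -P) * M * NormedSpace.exp (t • P) * N))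
      (reTrace (P * (N * M - M * N))) 0 := by
  have hcont : Continuous (reTrace (ι := ι)) := LinearMap.continuous_of_finiteDimensional _
  have e : reTrace (P * (N * M - M * N)) =
      reTrace ((NormedSpace.exp ((0 : ℝ) • -P) * -P * M * NormedSpace.exp ((0 : ℝ) • P) +
        NormedSpace.exp ((0 : ℝ) • -P) * M * (NormedSpace.exp ((0 : ℝ) • P) * P)) * N) := by
    have e1 : (-P * M + M * P) * N = (M * P) * N - P * M * N := by noncomm_ring
    have e2 : P * (N * M - M * N) = (P * N) * M - P * M * N := by noncomm_ring
    simp only [zero_smul, NormedSpace.exp_zero, one_mul, mul_one]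
    rw [e1, e2, map_sub, map_sub, mul_assoc M, reTrace_mul_comm M]
  rw [e]
  let _ : NormedRing (Matrix ι ι ℍ[ℝ]) := Matrix.linftyOpNormedRing
  let _ : NormedAlgebra ℝ (Matrix ι ι ℍ[ℝ]) := Matrix.linftyOpNormedAlgebra
  have h1 := hasDerivAt_exp_smul_const (𝕂 := ℝ) P 0
  have h2 := hasDerivAt_exp_smul_const (𝕂 := ℝ) (-P) 0
  have h3 := ((h2.mul_const M).mul h1).mul_const N
  let L : Matrix ι ι ℍ[ℝ] →L[ℝ] ℝ := ⟨reTrace, hcont⟩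
  exact L.hasFDerivAt.comp_hasDerivAt (0 : ℝ) h3

theorem exp_smul_mem_unitary {P : Matrix ι ι ℍ[ℝ]} (hP : Pᴴ = -P) (t : ℝ) :
    NormedSpace.exp (t • P) ∈ unitary (Matrix ι ι ℍ[ℝ]) := by
  let _ : NormedAlgebra ℚ ℍ[ℝ] := NormedAlgebra.restrictScalars ℚ ℝ _
  have hc : Commute (t • P) (-(t • P)) := (Commute.refl _).neg_right
  rw [Unitary.mem_iff, Matrix.star_eq_conjTranspose, ← Matrix.exp_conjTranspose,
    conjTranspose_real_smul, hP, smul_neg, ← Matrix.exp_add_of_commute _ _ hc.symm,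
    ← Matrix.exp_add_of_commute _ _ hc]
  simp

theorem commute_exp_smul {P D : Matrix ι ι ℍ[ℝ]} (h : Commute P D) (t : ℝ) :
    Commute (NormedSpace.exp (t • P)) D :=
  (h.smul_left t).exp_left

/-- The first-order condition at a maximum of `U ↦ re tr (Uᴴ B U N)` on the compact group of
unitary matrices commuting with `D`. -/
theorem exists_unitary_reTrace_commutator_eq_zero (D B N : Matrix ι ι ℍ[ℝ]) :
    ∃ U ∈ unitary (Matrix ι ι ℍ[ℝ]), U * D = D * U ∧
      ∀ P : Matrix ι ι ℍ[ℝ], Pᴴ = -P → P * D = D * P →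
        reTrace (P * (N * (Uᴴ * B * U) - (Uᴴ * B * U) * N)) = 0 := by
  have hcont : Continuous fun U : Matrix ι ι ℍ[ℝ] => reTrace (Uᴴ * B * U * N) := by
    have htr : Continuous (reTrace (ι := ι)) := LinearMap.continuous_of_finiteDimensional _
    have hmat : Continuous fun U : Matrix ι ι ℍ[ℝ] => Uᴴ * B * U * N :=
      ((continuous_id.matrix_conjTranspose.matrix_mul continuous_const).matrix_mul
        continuous_id).matrix_mul continuous_const
    exact htr.comp hmat
  obtain ⟨U, ⟨hU, hUD⟩, hmax⟩ := (isCompact_setOf_unitary_commute D).exists_isMaxOn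
    ⟨1, one_mem _, by simp⟩ hcont.continuousOn
  refine ⟨U, hU, hUD, fun P hP hPD => ?_⟩
  suffices hloc : IsLocalMax (fun t : ℝ => reTrace (NormedSpace.exp (t • -P) *
      (Uᴴ * B * U) * NormedSpace.exp (t • P) * N)) 0 from
    hloc.hasDerivAt_eq_zero (hasDerivAt_reTrace_exp (Uᴴ * B * U) N P)
  refine Filter.Eventually.of_forall fun t => ?_
  have hE := exp_smul_mem_unitary hP t
  have hEH : (NormedSpace.exp (t • P))ᴴ = NormedSpace.exp (t • -P) := by
    rw [← Matrix.exp_conjTranspose, conjTranspose_real_smul, hP]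
  have := hmax (show U * NormedSpace.exp (t • P) ∈ _ from ⟨mul_mem hU hE, by
    rw [mul_assoc, (commute_exp_smul hPD t).eq, ← mul_assoc, hUD, mul_assoc]⟩)
  simpa [Matrix.conjTranspose_mul, hEH, mul_assoc] using this

/-- With `M = Uᴴ B U`, the commutator `P = N M - M N` is skew-Hermitian and commutes with `D`, so it
is an admissible direction in the first-order condition, which then reads `re tr (P P) = 0`. -/
theorem exists_unitary_commute {D B N : Matrix ι ι ℍ[ℝ]} (hD : Dᴴ = -D) (hB : Bᴴ = -B)
    (hN : Nᴴ = -N) (hDB : D * B = B * D) (hDN : D * N = N * D) :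
    ∃ U ∈ unitary (Matrix ι ι ℍ[ℝ]), U * D = D * U ∧
      N * (Uᴴ * B * U) = (Uᴴ * B * U) * N := by
  obtain ⟨U, hU, hUD, h⟩ := exists_unitary_reTrace_commutator_eq_zero D B N
  refine ⟨U, hU, hUD, ?_⟩
  have hUD' : Uᴴ * D = D * Uᴴ := by
    have := congrArg Matrix.conjTranspose hUD
    simp only [Matrix.conjTranspose_mul, hD] at this
    simpa using this.symm
  generalize hM : Uᴴ * B * U = M at h ⊢
  have hMH : Mᴴ = -M := by
    rw [← hM]
    simp [Matrix.conjTranspose_mul, hB, mul_assoc]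
  have hMD : M * D = D * M := by
    rw [← hM, mul_assoc, hUD, ← mul_assoc, mul_assoc Uᴴ, ← hDB, ← mul_assoc, hUD']
    simp only [mul_assoc]
  have hskew : (N * M - M * N)ᴴ = -(N * M - M * N) := by
    simp only [Matrix.conjTranspose_sub, Matrix.conjTranspose_mul, hN, hMH]
    noncomm_ring
  have hcomm : (N * M - M * N) * D = D * (N * M - M * N) := by
    have hN' : Commute D N := hDN
    have hM' : Commute D M := hMD.symm
    exact ((hN'.mul_right hM').sub_right (hM'.mul_right hN')).eq.symm
  have h0 := h _ hskew hcomm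
  have h1 : N * M - M * N = 0 := by
    apply eq_zero_of_reTrace_mul_conjTranspose_self
    rw [hskew, mul_neg, map_neg, h0, neg_zero]
  exact sub_eq_zero.1 h1

end QuaternionMatrix

/-! ### Matrices commuting with a generic diagonal matrix -/

theorem IsUnitPureImaginary.star_eq_neg {η : ℍ[ℝ]} (hη : IsUnitPureImaginary η) :
    star η = -η :=
  Quaternion.star_eq_neg.2 hη.1

theorem IsUnitPureImaginary.mul_self {η : ℍ[ℝ]} (hη : IsUnitPureImaginary η) : η * η = -1 := by
  have h := Quaternion.self_mul_star η
  rw [hη.star_eq_neg, Quaternion.normSq_eq_norm_mul_self, hη.2] at h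
  rw [← neg_neg (η * η), ← mul_neg, h]
  simp

/-- A pure imaginary quaternion commuting with `η` is a real multiple of `η`: its product with `η`
is self-conjugate, hence real. -/
theorem IsUnitPureImaginary.exists_eq_smul {η m : ℍ[ℝ]} (hη : IsUnitPureImaginary η)
    (hm : star m = -m) (hcomm : η * m = m * η) : ∃ r : ℝ, m = r • η := by
  have hreal : star (η * m) = η * m := by
    rw [star_mul, hm, hη.star_eq_neg, neg_mul_neg, hcomm]
  rw [Quaternion.star_eq_self] at hreal
  refine ⟨-(η * m).re, ?_⟩
  calc
    m = -(η * (η * m)) := by rw [← mul_assoc, hη.mul_self]; simp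
    _ = -((η * m).re • η) := by
      nth_rewrite 1 [hreal]
      rw [Quaternion.mul_coe_eq_smul]
    _ = -(η * m).re • η := (neg_smul _ _).symm

namespace QuaternionMatrix

variable {n : ℕ}

/-- The diagonal matrix with entries `d k • η`. -/
noncomputable def etaDiagonal (η : ℍ[ℝ]) (d : Fin n → ℝ) : Matrix (Fin n) (Fin n) ℍ[ℝ] :=
  Matrix.diagonal fun k => d k • η

theorem etaDiagonal_conjTranspose {η : ℍ[ℝ]} (hη : IsUnitPureImaginary η) (d : Fin n → ℝ) :
    (etaDiagonal η d)ᴴ = -etaDiagonal η d := by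
  rw [etaDiagonal, Matrix.diagonal_conjTranspose, Matrix.diagonal_neg]
  congr 1
  funext k
  simp [Quaternion.star_smul, hη.star_eq_neg]

theorem etaDiagonal_mul_comm (η : ℍ[ℝ]) (c d : Fin n → ℝ) :
    etaDiagonal η c * etaDiagonal η d = etaDiagonal η d * etaDiagonal η c := by
  simp only [etaDiagonal, Matrix.diagonal_mul_diagonal, smul_mul_smul_comm, mul_comm]

/-- The moduli `k + 1` of the entries of the commuting diagonal matrix are distinct, which
annihilates the off-diagonal entries of `M`. -/
theorem exists_eq_etaDiagonal {η : ℍ[ℝ]} (hη : IsUnitPureImaginary η)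
    {M : Matrix (Fin n) (Fin n) ℍ[ℝ]} (hM : Mᴴ = -M)
    (hcomm : etaDiagonal η (fun k : Fin n => (k : ℝ) + 1) * M =
      M * etaDiagonal η (fun k : Fin n => (k : ℝ) + 1)) :
    ∃ d : Fin n → ℝ, M = etaDiagonal η d := by
  have hent (k l : Fin n) : ((k : ℝ) + 1) • η * M k l = M k l * ((l : ℝ) + 1) • η := by
    have := congrFun (congrFun hcomm k) l
    rwa [etaDiagonal, Matrix.diagonal_mul, Matrix.mul_diagonal] at this
  have hoff (k l : Fin n) (hkl : k ≠ l) : M k l = 0 := by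
    have h := congrArg norm (hent k l)
    have hk : ‖(k : ℝ) + 1‖ = (k : ℝ) + 1 := Real.norm_of_nonneg (by positivity)
    have hl : ‖(l : ℝ) + 1‖ = (l : ℝ) + 1 := Real.norm_of_nonneg (by positivity)
    rw [norm_mul, norm_mul, norm_smul, norm_smul, hη.2, mul_one, mul_one, hk, hl] at h
    have h0 : ((k : ℝ) - l) * ‖M k l‖ = 0 := by linarith
    rcases mul_eq_zero.1 h0 with h1 | h1
    · exact absurd (Fin.ext (by exact_mod_cast sub_eq_zero.1 h1)) hkl
    · exact norm_eq_zero.1 h1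
  have hdiag (k : Fin n) : ∃ r : ℝ, M k k = r • η := by
    apply hη.exists_eq_smul
    · exact congrFun (congrFun hM k) k
    · have h := hent k k
      rw [smul_mul_assoc, mul_smul_comm] at h
      exact smul_right_injective _ (by positivity : (k : ℝ) + 1 ≠ 0) h
  choose d hd using hdiag
  refine ⟨d, Matrix.ext fun k l => ?_⟩
  by_cases hkl : k = l
  · subst hkl
    rw [hd, etaDiagonal, Matrix.diagonal_apply_eq]
  · rw [hoff k l hkl, etaDiagonal, Matrix.diagonal_apply_ne _ hkl]

/-- The spectral theorem for skew-Hermitian quaternion matrices, within the centralizer of a given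
`D = diag (d k • η)`; for `D = 0` the commutation condition is void. -/
theorem exists_unitary_etaDiagonal {η : ℍ[ℝ]} (hη : IsUnitPureImaginary η) (d : Fin n → ℝ)
    {B : Matrix (Fin n) (Fin n) ℍ[ℝ]} (hB : Bᴴ = -B)
    (hdB : etaDiagonal η d * B = B * etaDiagonal η d) :
    ∃ U ∈ unitary (Matrix (Fin n) (Fin n) ℍ[ℝ]), U * etaDiagonal η d = etaDiagonal η d * U ∧
      ∃ m : Fin n → ℝ, Uᴴ * B * U = etaDiagonal η m := by
  obtain ⟨U, hU, hUd, hcomm⟩ := exists_unitary_commute (etaDiagonal_conjTranspose hη d) hB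
    (etaDiagonal_conjTranspose hη fun k : Fin n => (k : ℝ) + 1) hdB (etaDiagonal_mul_comm η _ _)
  refine ⟨U, hU, hUd, exists_eq_etaDiagonal hη ?_ hcomm⟩
  simp [Matrix.conjTranspose_mul, hB, mul_assoc]

end QuaternionMatrix

/-! ### Dual quaternion matrices by parts -/

namespace DualQuat

variable {n : ℕ}

/-- The dual quaternion matrix `X + ε Y` with standard part `X` and infinitesimal part `Y`. -/
def ofParts (X Y : Matrix (Fin n) (Fin n) ℍ[ℝ]) : Matrix (Fin n) (Fin n) DualQuat :=
  Matrix.of fun i j => (X i j, Y i j)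

theorem ofParts_map_fst_map_snd (A : Matrix (Fin n) (Fin n) DualQuat) :
    ofParts (A.map TrivSqZeroExt.fst) (A.map TrivSqZeroExt.snd) = A :=
  rfl

theorem ofParts_inj {X Y X' Y' : Matrix (Fin n) (Fin n) ℍ[ℝ]}
    (h : ofParts X Y = ofParts X' Y') : X = X' ∧ Y = Y' :=
  ⟨congrArg (fun A => A.map TrivSqZeroExt.fst) h, congrArg (fun A => A.map TrivSqZeroExt.snd) h⟩

theorem ofParts_mul (X Y X' Y' : Matrix (Fin n) (Fin n) ℍ[ℝ]) :
    ofParts X Y * ofParts X' Y' = ofParts (X * X') (X * Y' + Y * X') := by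
  refine Matrix.ext fun i j => TrivSqZeroExt.ext ?_ ?_
  · rw [Matrix.mul_apply, TrivSqZeroExt.fst_sum]
    rfl
  · rw [Matrix.mul_apply, TrivSqZeroExt.snd_sum]
    exact Finset.sum_add_distrib

theorem ofParts_conjTranspose (X Y : Matrix (Fin n) (Fin n) ℍ[ℝ]) :
    (ofParts X Y)ᴴ = ofParts Xᴴ Yᴴ :=
  rfl

theorem ofParts_neg (X Y : Matrix (Fin n) (Fin n) ℍ[ℝ]) : -ofParts X Y = ofParts (-X) (-Y) :=
  rfl

theorem ofParts_diagonal (a b : Fin n → ℍ[ℝ]) :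
    ofParts (Matrix.diagonal a) (Matrix.diagonal b) =
      Matrix.diagonal fun k => (TrivSqZeroExt.inl (a k) + TrivSqZeroExt.inr (b k) : DualQuat) := by
  refine Matrix.ext fun i j => ?_
  change ((Matrix.diagonal a i j, Matrix.diagonal b i j) : DualQuat) = _
  by_cases h : i = j
  · subst h
    rw [Matrix.diagonal_apply_eq, Matrix.diagonal_apply_eq, Matrix.diagonal_apply_eq]
    exact (TrivSqZeroExt.inl_fst_add_inr_snd_eq (R := ℍ[ℝ]) (M := ℍ[ℝ]) (a i, b i)).symm
  · rw [Matrix.diagonal_apply_ne _ h, Matrix.diagonal_apply_ne _ h, Matrix.diagonal_apply_ne _ h]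
    rfl

theorem ofParts_diagonal_zero (a : Fin n → ℍ[ℝ]) :
    ofParts (Matrix.diagonal a) 0 = Matrix.diagonal fun k => TrivSqZeroExt.inl (a k) := by
  rw [← Matrix.diagonal_zero, ofParts_diagonal]
  simp

theorem ofParts_one_zero : ofParts (1 : Matrix (Fin n) (Fin n) ℍ[ℝ]) 0 = 1 := by
  rw [← Matrix.diagonal_one, ofParts_diagonal_zero, TrivSqZeroExt.inl_one, Matrix.diagonal_one]

theorem ofParts_zero_mem_unitary {U : Matrix (Fin n) (Fin n) ℍ[ℝ]}
    (hU : U ∈ unitary (Matrix (Fin n) (Fin n) ℍ[ℝ])) :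
    ofParts U 0 ∈ unitary (Matrix (Fin n) (Fin n) DualQuat) := by
  rw [Unitary.mem_iff, Matrix.star_eq_conjTranspose] at hU ⊢
  rw [ofParts_conjTranspose, ofParts_mul, ofParts_mul, hU.1, hU.2]
  simp [ofParts_one_zero]

theorem ofParts_one_mem_unitary {Q : Matrix (Fin n) (Fin n) ℍ[ℝ]} (hQ : Qᴴ = -Q) :
    ofParts 1 Q ∈ unitary (Matrix (Fin n) (Fin n) DualQuat) := by
  rw [Unitary.mem_iff, Matrix.star_eq_conjTranspose]
  rw [ofParts_conjTranspose, ofParts_mul, ofParts_mul, hQ]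
  simp [ofParts_one_zero]

open QuaternionMatrix in
/-- The spectral theorem for skew-Hermitian dual quaternion matrices. The three factors of `V` bring
the standard part to `D`, make the infinitesimal part commute with `D`, and diagonalize the latter
without disturbing `D`. -/
theorem exists_unitary_mul_etaDiagonal {η : ℍ[ℝ]} (hη : IsUnitPureImaginary η)
    {X Y : Matrix (Fin n) (Fin n) ℍ[ℝ]} (hX : Xᴴ = -X) (hY : Yᴴ = -Y) :
    ∃ V ∈ unitary (Matrix (Fin n) (Fin n) DualQuat), ∃ d m : Fin n → ℝ,
      ofParts X Y = V * ofParts (etaDiagonal η d) (etaDiagonal η m) * Vᴴ := by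
  have hzero : etaDiagonal η (0 : Fin n → ℝ) = 0 := by simp [etaDiagonal]
  obtain ⟨U, hU, -, d, hd⟩ := exists_unitary_etaDiagonal hη 0 hX (by simp [hzero])
  obtain ⟨C, Q, hC, hQ, hDC, hCQ⟩ := exists_commute_add_commutator
    (etaDiagonal_conjTranspose hη d) (B := Uᴴ * Y * U)
    (by simp [Matrix.conjTranspose_mul, hY, mul_assoc])
  obtain ⟨W, hW, hWD, m, hm⟩ := exists_unitary_etaDiagonal hη d hC hDC
  have hUU : U * Uᴴ = 1 := Unitary.mul_star_self_of_mem hU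
  have hWW : W * Wᴴ = 1 := Unitary.mul_star_self_of_mem hW
  have cancel {U : Matrix (Fin n) (Fin n) ℍ[ℝ]} (hU : U * Uᴴ = 1)
      (Z : Matrix (Fin n) (Fin n) ℍ[ℝ]) : U * (Uᴴ * Z * U) * Uᴴ = Z := by
    rw [show U * (Uᴴ * Z * U) * Uᴴ = (U * Uᴴ) * Z * (U * Uᴴ) by simp only [mul_assoc], hU]
    simp
  generalize hDdef : etaDiagonal η d = D at *
  have h1 : ofParts X Y = ofParts U 0 * ofParts D (Uᴴ * Y * U) * (ofParts U 0)ᴴ := by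
    rw [← hd, ofParts_conjTranspose, ofParts_mul, ofParts_mul]
    simp [cancel hUU]
  -- Conjugation by `1 - ε Q` adds `ε (D Q - Q D)`.
  have h2 : ofParts D (Uᴴ * Y * U) = ofParts 1 (-Q) * ofParts D C * (ofParts 1 (-Q))ᴴ := by
    rw [hCQ, ofParts_conjTranspose, ofParts_mul, ofParts_mul]
    congr 1
    · simp
    · simp only [Matrix.conjTranspose_one, Matrix.conjTranspose_neg, hQ]
      noncomm_ring
  have h3 : ofParts D C = ofParts W 0 * ofParts D (etaDiagonal η m) * (ofParts W 0)ᴴ := by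
    rw [← hm, ofParts_conjTranspose, ofParts_mul, ofParts_mul]
    simp [cancel hWW, hWD, mul_assoc D, hWW]
  refine ⟨ofParts U 0 * ofParts 1 (-Q) * ofParts W 0,
    mul_mem (mul_mem (ofParts_zero_mem_unitary hU) (ofParts_one_mem_unitary (by simp [hQ])))
      (ofParts_zero_mem_unitary hW), d, m, ?_⟩
  rw [h1, h2, h3, hDdef]
  simp only [Matrix.conjTranspose_mul, mul_assoc]

/-- In terms of the scalar matrix `J = η I`, `A^{ηH} = -J Aᴴ J`. -/
theorem etaConjTranspose_eq {η : ℍ[ℝ]} (hη : IsUnitPureImaginary η)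
    (A : Matrix (Fin n) (Fin n) DualQuat) :
    etaConjTranspose η A =
      -(ofParts (Matrix.diagonal fun _ => η) 0 * Aᴴ * ofParts (Matrix.diagonal fun _ => η) 0) := by
  rw [ofParts_diagonal_zero]
  refine Matrix.ext fun i j => ?_
  rw [Matrix.neg_apply, Matrix.mul_diagonal, Matrix.diagonal_mul]
  simp only [etaConjTranspose, Matrix.map_apply, hη.star_eq_neg, TrivSqZeroExt.inl_neg, neg_mul]

end DualQuat

/-! ### The decomposition of `η`-Hermitian matrices -/

open DualQuat QuaternionMatrix in
theorem mainTheorem2 (n : ℕ) (η : ℍ[ℝ]) (hη : IsUnitPureImaginary η)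
    (A : Matrix (Fin n) (Fin n) DualQuat) (hA : IsEtaHermitian η A) :
    ∃ (V : Matrix (Fin n) (Fin n) DualQuat) (S : Matrix (Fin n) (Fin n) (DualNumber ℝ)),
      V ∈ unitary (Matrix (Fin n) (Fin n) DualQuat) ∧ S.IsDiag ∧
        A = V * S.map DualQuat.ofDualReal * etaConjTranspose η V := by
  set J := ofParts (Matrix.diagonal fun _ : Fin n => η) 0 with hJdef
  have hJJ : J * J = -1 := by
    rw [hJdef, ofParts_mul, Matrix.diagonal_mul_diagonal, ← ofParts_one_zero, ofParts_neg]
    simp [hη.mul_self, ← Matrix.diagonal_one, Matrix.diagonal_neg]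
  have hJH : Jᴴ = -J := by
    rw [hJdef, ofParts_conjTranspose, Matrix.diagonal_conjTranspose, ofParts_neg,
      Matrix.diagonal_neg]
    congr 1
    · congr 1
      funext
      exact hη.star_eq_neg
    · simp
  -- For `J = η I`, being `η`-Hermitian means that `A J` is skew-Hermitian.
  have hskew : (A * J)ᴴ = -(A * J) := by
    have h : A * J = J * Aᴴ := by
      conv_lhs => rw [show A = etaConjTranspose η A from hA, etaConjTranspose_eq hη, ← hJdef]
      rw [neg_mul, mul_assoc _ J J, hJJ, mul_neg, mul_one, neg_neg]
    rw [Matrix.conjTranspose_mul, hJH, h, neg_mul]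
  obtain ⟨V, hV, d, m, h⟩ := exists_unitary_mul_etaDiagonal hη
    (X := (A * J).map TrivSqZeroExt.fst) (Y := (A * J).map TrivSqZeroExt.snd)
    (ofParts_inj hskew).1 (ofParts_inj hskew).2
  rw [ofParts_map_fst_map_snd] at h
  let S : Matrix (Fin n) (Fin n) (DualNumber ℝ) :=
    Matrix.diagonal fun k => TrivSqZeroExt.inl (d k) + TrivSqZeroExt.inr (m k)
  refine ⟨V, S, hV, Matrix.isDiag_diagonal _, ?_⟩
  have hS : S.map DualQuat.ofDualReal * J =
      ofParts (etaDiagonal η d) (etaDiagonal η m) := by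
    have hmap : S.map DualQuat.ofDualReal =
        ofParts (Matrix.diagonal fun k => (d k : ℍ[ℝ])) (Matrix.diagonal fun k => (m k : ℍ[ℝ])) := by
      rw [ofParts_diagonal, Matrix.diagonal_map (by simp [DualQuat.ofDualReal])]
      simp [DualQuat.ofDualReal]
    rw [hmap, hJdef, ofParts_mul]
    simp [etaDiagonal, Matrix.diagonal_mul_diagonal, Quaternion.coe_mul_eq_smul]
  have hAJ : A = -(A * J * J) := by rw [mul_assoc, hJJ]; simp
  rw [hAJ, h, etaConjTranspose_eq hη, ← hJdef, ← hS]
  simp only [mul_neg, mul_assoc]
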